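/- Let $E$ be a real Banach space. A Katětov function on a metric space $X$ is a function $\xi\colon X\to\mathbf R$ with $\xi(x)\le \xi(y)+d(x,y)$ and $d(x,y)\le \xi(x)+\xi(y)$ for all $x,y\in X$; let $K(X)$ be the set of these, with the supremum distance. For non-empty $Y\subseteq X$ identify $\eta\in K(Y)$ with the function $x\mapsto\inf_{y\in Y}\bigl(d(x,y)+\eta(y)\bigr)$ in $K(X)$. Let $K_0(X)\subseteq K(X)$ be the closure of $\bigcup\{K(Y)\colon Y\subseteq X \text{ finite, non-empty}\}$, and let $K_{C,0}(E)$ be the set of convex functions in $K_0(E)$; it contains $E$ isometrically via $a\mapsto\|\cdot-a\|$. Let $E'=E[K_{C,0}(E)]$ be the Arens--Eells space of $K_{C,0}(E)$ over $E$: the closed linear span of the evaluations $f\mapsto f(\xi)$, $\xi\in K_{C,0}(E)$, with the norm $\bigl\|\sum_i\alpha_i\xi_i\bigr\|=\sup_f\bigl|\sum_i\alpha_i f(\xi_i)\bigr|$, where $f$ ranges over the $1$-Lipschitz functions $K_{C,0}(E)\to\mathbf R$ that are linear on $E$. Let $E_0=E$, $E_{n+1}=E_n'$, and let $E_\omega$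 be the completion of the union of the chain $E_0\subseteq E_1\subseteq\cdots$. Then: 1. $E'$ is a Banach space, the canonical map $K_{C,0}(E)\to E'$ is isometric and linear on $E$, and every Lipschitz map $\theta$ from $K_{C,0}(E)$ to a Banach space $F$ that is linear on $E$ has a unique continuous linear extension $\theta'\colon E'\to F$, which satisfies $\|\theta'\|\le L(\theta)$, where $L(\theta)$ is the Lipschitz constant of $\theta$. 2. $E'$ and $E_\omega$ are Banach space extensions of $E$: they are complete and the canonical maps $E\to E'$ and $E\to E_\omega$ are linear isometric embeddings, the second being the composite of the first with the inclusion $E'=E_1\to E_\omega$. 3. If $E\ne\{0\}$, then $w(E)=w(E')=w(E_\omega)$, where the weight $w(X)$ is the least cardinality of a base of the topology of $X$. 4. For every $\varepsilon>0$, every finite-dimensional normed space $F$, every subspace $F_0\subseteq F$ and every linear isometric embedding $\psi\colon F_0\to E_\omega$, there is an injective linear map $\varphi\colon F\to E_\omega$ extending $\psi$ with $(1-\varepsilon)\|x\|\le\|\varphi x\|\le(1+\varepsilon)\|x\|$ for all $x\in F$. In particular, if $E$ is separable, then $E_\omega$ is a Gurarij space, that is, a separable Banach space with this extension property. -/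

import Mathlib

open Set Topology
open scoped NNReal ENNReal

universe u v w

noncomputable section

namespace GurarijConstruction

/-- The weight of a topological space: the least cardinality of a base. -/
def weight (X : Type u) [TopologicalSpace X] : Cardinal.{u} :=
  ⨅ B : {B : Set (Set X) // TopologicalSpace.IsTopologicalBasis B}, Cardinal.mk B.1

/-! ### Katětov functions -/

/-- Katětov functions on a metric space. -/
def IsKatetov {X : Type u} [MetricSpace X] (ξ : X → ℝ) : Prop :=
  ∀ x y, ξ x ≤ ξ y + dist x y ∧ dist x y ≤ ξ x + ξ y

/-- `K(X)`, the set of all Katětov functions on `X`. -/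
def Katetov (X : Type u) [MetricSpace X] : Type u := {ξ : X → ℝ // IsKatetov ξ}

namespace Katetov

variable {X : Type u} [MetricSpace X]

instance : CoeFun (Katetov X) (fun _ => X → ℝ) := ⟨fun ξ => ξ.1⟩

theorem abs_sub_le (ξ η : Katetov X) (x y : X) : |ξ x - η x| ≤ ξ y + η y := by
  have h1 := ξ.2 x y
  have h2 := η.2 x y
  rw [abs_le]
  constructor <;> linarith

theorem bddAbove (ξ η : Katetov X) : BddAbove (range fun x => |ξ x - η x|) := by
  rcases isEmpty_or_nonempty X with h | ⟨⟨y⟩⟩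
  · rw [range_eq_empty]
    exact bddAbove_empty
  · exact ⟨ξ y + η y, by rintro _ ⟨x, rfl⟩; exact abs_sub_le ξ η x y⟩

/-- `K(X)` carries the supremum distance (the supremum is always finite). -/
instance : MetricSpace (Katetov X) where
  dist ξ η := ⨆ x, |ξ x - η x|
  dist_self ξ := by simp
  dist_comm ξ η := by simp only [abs_sub_comm]
  dist_triangle ξ η ζ := by
    refine Real.iSup_le (fun x => ?_) (add_nonneg (Real.iSup_nonneg fun _ => abs_nonneg _)
      (Real.iSup_nonneg fun _ => abs_nonneg _))
    calc |ξ x - ζ x| ≤ |ξ x - η x| + |η x - ζ x| := _root_.abs_sub_le _ _ _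
      _ ≤ _ := add_le_add (le_ciSup (bddAbove ξ η) x) (le_ciSup (bddAbove η ζ) x)
  eq_of_dist_eq_zero := by
    intro ξ η h
    apply Subtype.ext
    funext x
    have h1 : |ξ x - η x| ≤ ⨆ x, |ξ x - η x| := le_ciSup (bddAbove ξ η) x
    have h2 : |ξ x - η x| ≤ 0 := h1.trans (le_of_eq h)
    exact sub_eq_zero.1 (abs_eq_zero.1 (le_antisymm h2 (abs_nonneg _)))

theorem dist_def (ξ η : Katetov X) : dist ξ η = ⨆ x, |ξ x - η x| := rfl

/-- The image of `K(Y)` in `K(X)` for a non-empty subset `Y ⊆ X`: all functions of the form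
`x ↦ inf_{y ∈ Y} (d(x, y) + η(y))` with `η ∈ K(Y)`. -/
def supportedOn (Y : Set X) : Set (Katetov X) :=
  {ξ | ∃ η : Katetov Y, ∀ x, ξ x = ⨅ y : Y, (dist x (y : X) + η y)}

end Katetov

/-- `K₀(X)`: the closure in `K(X)` of the union of the images of `K(Y)`, `Y ⊆ X` finite
(and non-empty). -/
def katetovZero (X : Type u) [MetricSpace X] : Set (Katetov X) :=
  closure (⋃ Y ∈ {Y : Set X | Y.Finite ∧ Y.Nonempty}, Katetov.supportedOn Y)

/-- `K_C(E)`: the convex Katětov functions on a normed space `E`. -/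
def katetovConvex (E : Type u) [NormedAddCommGroup E] [NormedSpace ℝ E] : Set (Katetov E) :=
  {ξ | ConvexOn ℝ univ ξ.1}

/-- `K_{C,0}(E) = K₀(E) ∩ K_C(E)`, a metric space for the supremum distance. -/
abbrev KC0 (E : Type u) [NormedAddCommGroup E] [NormedSpace ℝ E] : Type u :=
  ↥(katetovZero E ∩ katetovConvex E)

/-- The function `x ↦ d(x, a)` as an element of `K(X)`. -/
def Katetov.of {X : Type u} [MetricSpace X] (a : X) : Katetov X :=
  ⟨fun x => dist x a, fun x y => ⟨by rw [add_comm]; exact dist_triangle x y a,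
    dist_triangle_right x y a⟩⟩

theorem Katetov.dist_of {X : Type u} [MetricSpace X] (a b : X) :
    dist (Katetov.of a) (Katetov.of b) = dist a b := by
  rw [Katetov.dist_def]
  apply le_antisymm
  · refine Real.iSup_le (fun x => ?_) dist_nonneg
    have := abs_dist_sub_le a b x
    simpa [Katetov.of, dist_comm] using this
  · refine le_trans ?_ (le_ciSup (Katetov.bddAbove (Katetov.of a) (Katetov.of b)) a)
    simp [Katetov.of]

/-- The canonical embedding `E ↪ K_{C,0}(E)`, `a ↦ ‖· - a‖`. -/
def KC0.of (E : Type u) [NormedAddCommGroup E] [NormedSpace ℝ E] (a : E) : KC0 E :=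
  ⟨Katetov.of a, by
    constructor
    · refine subset_closure ?_
      simp only [mem_iUnion]
      refine ⟨{a}, ⟨finite_singleton a, singleton_nonempty a⟩,
        Katetov.of (⟨a, rfl⟩ : ({a} : Set E)), fun x => ?_⟩
      simp [Katetov.of]
    · exact convexOn_univ_dist a⟩

theorem KC0.isometry_of (E : Type u) [NormedAddCommGroup E] [NormedSpace ℝ E] :
    Isometry (KC0.of E) :=
  Isometry.of_dist_eq fun a b => Katetov.dist_of a b

/-! ### The Arens-Eells space of a metric space over a normed space -/

section ArensEells

variable {E : Type u} [NormedAddCommGroup E] [NormedSpace ℝ E] {X : Type u} [MetricSpace X]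

/-- The unit ball of `Lip_E(X)`: the `1`-Lipschitz functions `X → ℝ` that are linear on `E`,
where `φ : E → X` is the structure map. -/
def LipBall (φ : E → X) : Type u :=
  {f : X → ℝ // LipschitzWith 1 f ∧ IsLinearMap ℝ (f ∘ φ)}

theorem LipBall.abs_le {φ : E → X} (f : LipBall φ) (x : X) : |f.1 x| ≤ dist x (φ 0) := by
  have h := f.2.1.dist_le_mul x (φ 0)
  have h0 : f.1 (φ 0) = 0 := f.2.2.map_zero
  simpa [h0, Real.dist_eq] using h

/-- Evaluation at `x ∈ X`, as a bounded function on the unit ball of `Lip_E(X)`. -/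
def evalAt (φ : E → X) (x : X) : lp (fun _ : LipBall φ => ℝ) ∞ :=
  ⟨fun f => f.1 x, memℓp_infty ⟨dist x (φ 0), by rintro _ ⟨f, rfl⟩; exact f.abs_le x⟩⟩

/-- The Arens-Eells space of `X` over `E`: the closed linear span of the evaluations at the points
of `X`, with the norm dual to that of `Lip_E(X)`, i.e.
`‖∑ αᵢ xᵢ‖ = sup {|∑ αᵢ f(xᵢ)| : f ∈ Lip_E(X), L(f) ≤ 1}`. -/
def ArensEells (φ : E → X) : Type u :=
  ↥(Submodule.span ℝ (range (evalAt φ))).topologicalClosure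

namespace ArensEells

instance (φ : E → X) : NormedAddCommGroup (ArensEells φ) :=
  inferInstanceAs (NormedAddCommGroup ↥(Submodule.span ℝ (range (evalAt φ))).topologicalClosure)

instance (φ : E → X) : NormedSpace ℝ (ArensEells φ) :=
  inferInstanceAs (NormedSpace ℝ ↥(Submodule.span ℝ (range (evalAt φ))).topologicalClosure)

instance (φ : E → X) : CompleteSpace (ArensEells φ) :=
  inferInstanceAs (CompleteSpace ↥(Submodule.span ℝ (range (evalAt φ))).topologicalClosure)

/-- The canonical map of `X` into its Arens-Eells space. -/
def of (φ : E → X) (x : X) : ArensEells φ :=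
  ⟨evalAt φ x, Submodule.le_topologicalClosure _ (Submodule.subset_span (mem_range_self x))⟩

theorem isLinearMap_of (φ : E → X) : IsLinearMap ℝ (of φ ∘ φ) where
  map_add a b := Subtype.ext <| lp.ext <| funext fun f : LipBall φ => f.2.2.map_add a b
  map_smul c a := Subtype.ext <| lp.ext <| funext fun f : LipBall φ => f.2.2.map_smul c a

theorem norm_of (φ : E → X) (hφ : Isometry φ) (a : E) : ‖of φ (φ a)‖ = ‖a‖ := by
  change ‖evalAt φ (φ a)‖ = ‖a‖
  apply le_antisymm
  · refine lp.norm_le_of_forall_le (norm_nonneg a) fun f => ?_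
    have h := f.abs_le (φ a)
    rwa [hφ.dist_eq, dist_zero_right] at h
  · obtain ⟨g, hg, hga⟩ := exists_dual_vector'' ℝ a
    have hlip : LipschitzOnWith 1 (Function.extend φ g 0) (range φ) := by
      refine LipschitzOnWith.of_dist_le_mul ?_
      rintro _ ⟨b, rfl⟩ _ ⟨c, rfl⟩
      rw [hφ.injective.extend_apply, hφ.injective.extend_apply, hφ.dist_eq, dist_eq_norm,
        dist_eq_norm, ← map_sub]
      exact (g.le_opNorm _).trans (mul_le_mul_of_nonneg_right hg (norm_nonneg _))
    obtain ⟨f, hf, hfg⟩ := hlip.extend_real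
    have hfφ : f ∘ φ = g := by
      funext b
      have := hfg (mem_range_self b)
      rw [hφ.injective.extend_apply] at this
      exact this.symm
    let F : LipBall φ := ⟨f, hf, by rw [hfφ]; exact g.toLinearMap.isLinear⟩
    have h1 := lp.norm_apply_le_norm ENNReal.top_ne_zero (evalAt φ (φ a)) F
    have h2 : evalAt φ (φ a) F = ‖a‖ := by
      change (f ∘ φ) a = ‖a‖
      rw [hfφ]
      exact hga
    rw [h2, norm_norm] at h1
    exact h1

/-- The inclusion `E → AE(X, E)` as a linear isometry. -/
def incl (φ : E → X) (hφ : Isometry φ) : E →ₗᵢ[ℝ] ArensEells φ where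
  toLinearMap := (isLinearMap_of φ).mk' _
  norm_map' a := norm_of φ hφ a

end ArensEells

/-- `A`, with the map `j : X → A`, has the properties that characterise the Arens-Eells space of
the metric space `φ : E → X` over `E`: `j` is isometric and linear on `E`, and every Lipschitz map
`θ` from `X` to a Banach space `F` that is linear on `E` has a unique continuous linear extension
`T : A → F`, which satisfies `‖T‖ ≤ L(θ)`. -/
structure IsArensEells (φ : E → X) (A : Type u) [NormedAddCommGroup A] [NormedSpace ℝ A]
    (j : X → A) : Prop where
  complete : CompleteSpace A
  isometry : Isometry j
  isLinearMap : IsLinearMap ℝ (j ∘ φ)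
  extend : ∀ (F : Type v) [NormedAddCommGroup F] [NormedSpace ℝ F] [CompleteSpace F]
    (θ : X → F) (L : ℝ≥0), LipschitzWith L θ → IsLinearMap ℝ (θ ∘ φ) →
    ∃ T : A →L[ℝ] F, ((∀ x, T (j x) = θ x) ∧ ‖T‖ ≤ L) ∧
      ∀ S : A →L[ℝ] F, (∀ x, S (j x) = θ x) → S = T

end ArensEells

/-! ### The space `E'` -/

/-- `E' = E[K_{C,0}(E)]`. -/
abbrev Prime (E : Type u) [NormedAddCommGroup E] [NormedSpace ℝ E] : Type u :=
  ArensEells (KC0.of E)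

/-- The inclusion `E → E'`. -/
def Prime.incl (E : Type u) [NormedAddCommGroup E] [NormedSpace ℝ E] : E →ₗᵢ[ℝ] Prime E :=
  ArensEells.incl (KC0.of E) (KC0.isometry_of E)

/-! ### The completed union of a chain of isometric inclusions -/

section SeqLimit

variable {G : ℕ → Type u} [∀ n, NormedAddCommGroup (G n)] [∀ n, NormedSpace ℝ (G n)]

/-- The composite inclusion `G m → G n`, `m ≤ n`. -/
def seqMap (j : ∀ n, G n →ₗᵢ[ℝ] G (n + 1)) (m n : ℕ) (h : m ≤ n) : G m →ₗᵢ[ℝ] G n :=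
  Nat.leRec (motive := fun k _ => G m →ₗᵢ[ℝ] G k) LinearIsometry.id
    (fun k _ g => (j k).comp g) h

theorem seqMap_self (j : ∀ n, G n →ₗᵢ[ℝ] G (n + 1)) (m : ℕ) :
    seqMap j m m le_rfl = LinearIsometry.id := by
  simp [seqMap]

theorem seqMap_succ (j : ∀ n, G n →ₗᵢ[ℝ] G (n + 1)) (m n : ℕ) (h : m ≤ n) :
    seqMap j m (n + 1) (h.trans n.le_succ) = (j n).comp (seqMap j m n h) := by
  simp only [seqMap]
  exact Nat.leRec_succ _ _ h

instance seqMap_directedSystem (j : ∀ n, G n →ₗᵢ[ℝ] G (n + 1)) :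
    DirectedSystem G (fun m n h => seqMap j m n h) where
  map_self m x := by rw [seqMap_self]; rfl
  map_map := by
    intro k i m hmi hik x
    induction k, hik using Nat.le_induction with
    | base => rw [seqMap_self]; rfl
    | succ k hik ih =>
      rw [seqMap_succ j i k hik, seqMap_succ j m k (hmi.trans hik)]
      exact congrArg (j k) ih

/-- The union of the chain `G 0 → G 1 → ⋯`. -/
def SeqUnion (j : ∀ n, G n →ₗᵢ[ℝ] G (n + 1)) : Type u :=
  DirectLimit G (fun m n h => seqMap j m n h)

namespace SeqUnion

variable (j : ∀ n, G n →ₗᵢ[ℝ] G (n + 1))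

instance : AddCommGroup (SeqUnion j) :=
  inferInstanceAs (AddCommGroup (DirectLimit G (fun m n h => seqMap j m n h)))

instance : Module ℝ (SeqUnion j) :=
  inferInstanceAs (Module ℝ (DirectLimit G (fun m n h => seqMap j m n h)))

/-- The inclusion of `G n` in the union. -/
def of (n : ℕ) : G n →ₗ[ℝ] SeqUnion j :=
  DirectLimit.Module.of ℝ ℕ G (fun m n h => seqMap j m n h) n

theorem of_seqMap (m n : ℕ) (h : m ≤ n) (x : G m) : of j n (seqMap j m n h x) = of j m x :=
  DirectLimit.mk_apply m n x h

theorem exists_of (z : SeqUnion j) : ∃ n x, z = of j n x :=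
  DirectLimit.exists_eq_mk _ z

theorem exists_of₂ (z w : SeqUnion j) : ∃ n x y, z = of j n x ∧ w = of j n y :=
  DirectLimit.exists_eq_mk₂ _ z w

instance : Norm (SeqUnion j) where
  norm := DirectLimit.lift (fun m n h => seqMap j m n h) (fun _ x => ‖x‖)
    (fun m n h x => ((seqMap j m n h).norm_map x).symm)

theorem norm_of (n : ℕ) (x : G n) : ‖of j n x‖ = ‖x‖ := rfl

theorem normCore : NormedSpace.Core ℝ (SeqUnion j) where
  norm_nonneg z := by
    obtain ⟨n, x, rfl⟩ := exists_of j z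
    exact norm_nonneg x
  norm_smul c z := by
    obtain ⟨n, x, rfl⟩ := exists_of j z
    rw [← map_smul, norm_of, norm_of, norm_smul]
  norm_triangle z w := by
    obtain ⟨n, x, y, rfl, rfl⟩ := exists_of₂ j z w
    rw [← map_add, norm_of, norm_of, norm_of]
    exact norm_add_le x y
  norm_eq_zero_iff z := by
    obtain ⟨n, x, rfl⟩ := exists_of j z
    constructor
    · intro h
      rw [norm_of, norm_eq_zero] at h
      rw [h, map_zero]
    · intro h
      rw [h]
      have h0 := norm_of j 0 0
      rwa [map_zero, norm_zero] at h0

instance : NormedAddCommGroup (SeqUnion j) := NormedAddCommGroup.ofCore (normCore j)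

instance : NormedSpace ℝ (SeqUnion j) := NormedSpace.ofCore (normCore j)

end SeqUnion

/-- The completion of the union of the chain. -/
abbrev SeqLimit (j : ∀ n, G n →ₗᵢ[ℝ] G (n + 1)) : Type u :=
  UniformSpace.Completion (SeqUnion j)

/-- The inclusion of `G n` in the completed union. -/
def SeqLimit.of (j : ∀ n, G n →ₗᵢ[ℝ] G (n + 1)) (n : ℕ) : G n →ₗᵢ[ℝ] SeqLimit j :=
  (UniformSpace.Completion.toComplₗᵢ (𝕜 := ℝ) (E := SeqUnion j)).comp
    { toLinearMap := SeqUnion.of j n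
      norm_map' := SeqUnion.norm_of j n }

end SeqLimit

/-! ### The space `E_ω` -/

/-- Real Banach spaces, bundled, so that the chain `E_n` can be defined by recursion. -/
structure BanachSpace : Type (u + 1) where
  carrier : Type u
  [normed : NormedAddCommGroup carrier]
  [space : NormedSpace ℝ carrier]
  [complete : CompleteSpace carrier]

attribute [instance] BanachSpace.normed BanachSpace.space BanachSpace.complete

/-- `E_0 = E`, `E_{n+1} = E_n'`. -/
def chain (E : Type u) [NormedAddCommGroup E] [NormedSpace ℝ E] [CompleteSpace E] :
    ℕ → BanachSpace.{u}
  | 0 => ⟨E⟩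
  | n + 1 => ⟨Prime (chain E n).carrier⟩

/-- The inclusion `E_n → E_{n+1} = E_n'`. -/
def chainIncl (E : Type u) [NormedAddCommGroup E] [NormedSpace ℝ E] [CompleteSpace E] (n : ℕ) :
    (chain E n).carrier →ₗᵢ[ℝ] (chain E (n + 1)).carrier :=
  Prime.incl (chain E n).carrier

/-- `E_ω`, the completion of the union of the chain `E = E_0 ⊆ E_1 ⊆ E_2 ⊆ ⋯`. -/
abbrev Omega (E : Type u) [NormedAddCommGroup E] [NormedSpace ℝ E] [CompleteSpace E] : Type u :=
  SeqLimit (chainIncl E)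

/-- The inclusion `E = E_0 → E_ω`. -/
def Omega.incl (E : Type u) [NormedAddCommGroup E] [NormedSpace ℝ E] [CompleteSpace E] :
    E →ₗᵢ[ℝ] Omega E :=
  SeqLimit.of (chainIncl E) 0

/-- The inclusion `E' = E_1 → E_ω`. -/
def Omega.inclPrime (E : Type u) [NormedAddCommGroup E] [NormedSpace ℝ E] [CompleteSpace E] :
    Prime E →ₗᵢ[ℝ] Omega E :=
  SeqLimit.of (chainIncl E) 1

/-! ### Gurarij spaces -/

/-- For every `ε > 0`, every finite-dimensional normed space `F`, every subspace `F₀` of `F` and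
every linear isometric embedding `ψ : F₀ → G` there is an injective linear map `φ : F → G`
extending `ψ` with `(1 - ε)‖x‖ ≤ ‖φ x‖ ≤ (1 + ε)‖x‖` for all `x ∈ F`. -/
def HasApproxExtension (G : Type u) [NormedAddCommGroup G] [NormedSpace ℝ G] : Prop :=
  ∀ ε : ℝ, 0 < ε → ∀ (F : Type v) [NormedAddCommGroup F] [NormedSpace ℝ F] [FiniteDimensional ℝ F]
    (F₀ : Submodule ℝ F) (ψ : F₀ →ₗᵢ[ℝ] G),
    ∃ φ : F →ₗ[ℝ] G, Function.Injective φ ∧ (∀ x : F₀, φ x = ψ x) ∧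
      ∀ x : F, (1 - ε) * ‖x‖ ≤ ‖φ x‖ ∧ ‖φ x‖ ≤ (1 + ε) * ‖x‖

/-- Gurarij spaces. -/
structure IsGurarij (G : Type u) [NormedAddCommGroup G] [NormedSpace ℝ G] : Prop where
  complete : CompleteSpace G
  separable : TopologicalSpace.SeparableSpace G
  extension : HasApproxExtension.{u, v} G

end GurarijConstruction

end

/-!
A Katětov function `ξ` on a normed space `E` prescribes the distances `ξ a` from the points `a` of
`E` to a virtual new point. When `ξ` is convex, the virtual point can be added linearly: `ξ` has
for each point `x` an affine minorant that almost touches it at `x`, whose linear part has norm at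
most `1`; the greatest `1`-Lipschitz extension of minus that linear part to `K_{C,0}(E)` then almost
attains `ξ x - ζ x` for every `ζ`. So the canonical map into the Arens-Eells space is isometric
(`KC0.isometry_arensEells_of`). Its universal property follows from the Hahn-Banach theorem, which
reduces the norm estimate to real-valued maps (`ArensEells.norm_linearCombination_le`).

The weight is controlled through dense sets. A function in `K₀(E)` is determined up to `ε` by
finitely many points and its values there, which may be taken in a dense set and in `ℚ`, so none
of the constructions raises an infinite density character (`KC0.densityLE`,
`ArensEells.densityLE`, `SeqLimit.densityLE`).

For the extension property, let `T` map a finite-dimensional subspace `W ⊆ F` linearly into `E` with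
`a ‖x‖ ≤ ‖T x‖ ≤ b ‖x‖`, let `v ∈ F` and `b < c`. The function
`z ↦ inf_{x ∈ W} (‖z - T x‖ + c ‖x - v‖)` on `E` is Katětov and convex, and its value at `T x` lies
between `a ‖x - v‖` and `c ‖x - v‖`. Because `b < c`, only a bounded, hence totally bounded, set
of `x` matters for the infimum, so the function belongs to `K₀(E)`. Sending `v` to it extends `T` to
`W + ℝ v`, with values in `E'` and with bounds `a` and `c`
(`Prime.exists_extension_sup_span_singleton`). No renorming is needed to iterate this along the
chain. An isometric embedding into `E_ω` is first approximated by a map into some `E_n`, and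
the extension of the approximation is corrected by a small linear map
(`Omega.hasApproxExtension`).
-/

noncomputable section

namespace GurarijConstruction

/-! ### Katětov functions and their distances -/

namespace Katetov

variable {X : Type u} [MetricSpace X]

theorem abs_apply_sub_le_dist (ξ η : Katetov X) (x : X) : |ξ x - η x| ≤ dist ξ η :=
  le_ciSup (bddAbove ξ η) x

theorem dist_le_of_forall {ξ η : Katetov X} {r : ℝ} (hr : 0 ≤ r)
    (h : ∀ x, |ξ x - η x| ≤ r) : dist ξ η ≤ r :=
  Real.iSup_le h hr

theorem nonneg (ξ : Katetov X) (x : X) : 0 ≤ ξ x := by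
  have h := (ξ.2 x x).2
  rw [dist_self] at h
  linarith

/-- Katětov functions are distances to a virtual point: the distance in `K(X)` from `ξ` to a point
`a` of `X` is `ξ a`. -/
theorem dist_of_right (ξ : Katetov X) (a : X) : dist ξ (of a) = ξ a := by
  apply le_antisymm
  · refine dist_le_of_forall (ξ.nonneg a) fun x => abs_le.2 ⟨?_, ?_⟩
    · have := (ξ.2 x a).2
      simp only [of]
      linarith
    · have := (ξ.2 x a).1
      simp only [of]
      linarith
  · have h := abs_apply_sub_le_dist ξ (of a) a
    simp only [of, dist_self, sub_zero] at h
    exact (le_abs_self _).trans h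

theorem bddBelow_range_dist_add {Y : Set X} (η : Katetov Y) (x : X) :
    BddBelow (range fun y : Y => dist x (y : X) + η y) :=
  ⟨0, by rintro _ ⟨y, rfl⟩; exact add_nonneg dist_nonneg (η.nonneg y)⟩

end Katetov

/-- Membership in `K₀(X)` in terms of the function alone: up to `ε`, the function is the greatest
`1`-Lipschitz function with its values on some finite set. -/
theorem mem_katetovZero_iff {X : Type u} [MetricSpace X] [Nonempty X] {ξ : Katetov X} :
    ξ ∈ katetovZero X ↔
      ∀ ε > 0, ∃ Y : Set X, Y.Finite ∧ ∀ x, ∃ y ∈ Y, dist x y + ξ y ≤ ξ x + ε := by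
  constructor
  · intro h ε hε
    obtain ⟨ζ, hζ, hd⟩ := Metric.mem_closure_iff.1 h (ε / 3) (by positivity)
    simp only [mem_iUnion] at hζ
    obtain ⟨Y, ⟨hYf, hYn⟩, η, hη⟩ := hζ
    have : Nonempty Y := hYn.to_subtype
    refine ⟨Y, hYf, fun x => ?_⟩
    obtain ⟨y, hy⟩ := exists_lt_of_ciInf_lt
      (show (⨅ y : Y, (dist x (y : X) + η y)) < ζ x + ε / 3 by rw [← hη]; linarith)
    refine ⟨y, y.2, ?_⟩
    have h1 : ζ y ≤ η y := by
      rw [hη]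
      exact (ciInf_le (Katetov.bddBelow_range_dist_add η _) y).trans (by simp)
    have h2 := (abs_le.1 (Katetov.abs_apply_sub_le_dist ξ ζ x)).1
    have h3 := (abs_le.1 (Katetov.abs_apply_sub_le_dist ξ ζ y)).2
    linarith
  · intro h
    refine Metric.mem_closure_iff.2 fun ε hε => ?_
    obtain ⟨Y, hYf, hY⟩ := h (ε / 2) (by positivity)
    have hYn : Y.Nonempty := by
      obtain ⟨y, hy, -⟩ := hY (Classical.arbitrary X)
      exact ⟨y, hy⟩
    have : Nonempty Y := hYn.to_subtype
    let η : Katetov Y := ⟨fun y => ξ y, fun x y => ξ.2 x y⟩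
    let ζ : Katetov X := ⟨fun x => ⨅ y : Y, (dist x (y : X) + η y), fun x y => by
      constructor
      · rw [← sub_le_iff_le_add]
        refine le_ciInf fun z => ?_
        have h1 := ciInf_le (Katetov.bddBelow_range_dist_add η x) z
        have h2 := dist_triangle x y z
        simp only at h1 ⊢
        linarith
      · have h1 : dist x y - (⨅ z : Y, (dist y (z : X) + η z)) ≤
            ⨅ z : Y, (dist x (z : X) + η z) := by
          refine le_ciInf fun z => ?_
          rw [sub_le_comm]
          refine le_ciInf fun z' => ?_
          have h2 := (η.2 z z').2
          have h3 := dist_triangle4 x z z' y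
          rw [Subtype.dist_eq] at h2
          rw [dist_comm (z' : X) y] at h3
          linarith
        linarith⟩
    refine ⟨ζ, ?_, ?_⟩
    · simp only [mem_iUnion]
      exact ⟨Y, ⟨hYf, hYn⟩, η, fun _ => rfl⟩
    · refine lt_of_le_of_lt (Katetov.dist_le_of_forall (r := ε / 2) (by positivity) fun x => ?_)
        (by linarith)
      have h1 : ξ x ≤ ζ x := le_ciInf fun y => by
        have := (ξ.2 x y).1
        simp only [η]
        linarith
      obtain ⟨y, hy, hxy⟩ := hY x
      have h2 : ζ x ≤ dist x y + ξ y := ciInf_le (Katetov.bddBelow_range_dist_add η x) ⟨y, hy⟩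
      rw [abs_le]
      constructor <;> linarith

theorem KC0.dist_of_right {E : Type u} [NormedAddCommGroup E] [NormedSpace ℝ E]
    (ξ : KC0 E) (a : E) : dist ξ (KC0.of E a) = ξ.1 a :=
  Katetov.dist_of_right ξ.1 a

/-! ### The universal property of the Arens-Eells space -/

section ArensEells

variable {E : Type u} [NormedAddCommGroup E] [NormedSpace ℝ E] {X : Type u} [MetricSpace X]

/-- The greatest `1`-Lipschitz extension to `X` of a linear functional of norm at most `1`
on `E`. -/
def LipBall.mcShane {φ : E → X} (hφ : Isometry φ) (l : E →ₗ[ℝ] ℝ) (hl : ∀ y, l y ≤ ‖y‖) :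
    {f : LipBall φ // (∀ x y, f.1 x ≤ dist x (φ y) + l y) ∧
      ∀ x c, (∀ y, c ≤ dist x (φ y) + l y) → c ≤ f.1 x} := by
  have hbdd (x : X) : BddBelow (range fun y => dist x (φ y) + l y) := by
    refine ⟨-dist x (φ 0), ?_⟩
    rintro _ ⟨y, rfl⟩
    have h1 := hl (-y)
    have h2 := dist_triangle_left (φ y) (φ 0) x
    rw [hφ.dist_eq, dist_zero_right] at h2
    rw [map_neg, norm_neg] at h1
    linarith
  have hval (y : E) : (⨅ z, (dist (φ y) (φ z) + l z)) = l y := by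
    apply le_antisymm
    · exact (ciInf_le (hbdd (φ y)) y).trans (by simp)
    · refine le_ciInf fun z => ?_
      have h1 := hl (y - z)
      rw [map_sub, ← dist_eq_norm] at h1
      rw [hφ.dist_eq]
      linarith
  refine ⟨⟨fun x => ⨅ y, (dist x (φ y) + l y), ?_, ?_⟩, ?_, ?_⟩
  · refine LipschitzWith.of_le_add fun x y => ?_
    rw [← sub_le_iff_le_add]
    refine le_ciInf fun z => ?_
    have h1 := ciInf_le (hbdd x) z
    have h2 := dist_triangle x y (φ z)
    linarith
  · have : (fun x => ⨅ y, (dist x (φ y) + l y)) ∘ φ = l := funext hval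
    rw [this]
    exact l.isLinear
  · exact fun x y => ciInf_le (hbdd x) y
  · exact fun x c h => le_ciInf h

namespace ArensEells

theorem coe_of (φ : E → X) (x : X) : (of φ x).1 = evalAt φ x := rfl

theorem norm_of_sub_le (φ : E → X) (x y : X) : ‖of φ x - of φ y‖ ≤ dist x y := by
  change ‖evalAt φ x - evalAt φ y‖ ≤ _
  refine lp.norm_le_of_forall_le dist_nonneg fun f => ?_
  have h := f.2.1.dist_le_mul x y
  rw [Real.dist_eq, NNReal.coe_one, one_mul] at h
  exact h

theorem sub_le_norm_of_sub (φ : E → X) (f : LipBall φ) (x y : X) :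
    f.1 x - f.1 y ≤ ‖of φ x - of φ y‖ :=
  (le_abs_self _).trans (lp.norm_apply_le_norm ENNReal.top_ne_zero (evalAt φ x - evalAt φ y) f)

/-- Formal linear combinations of points of `X`, evaluated in the Arens-Eells space. -/
def combination (φ : E → X) : (X →₀ ℝ) →ₗ[ℝ] ArensEells φ :=
  Finsupp.linearCombination ℝ (of φ)

theorem combination_single (φ : E → X) (x : X) : combination φ (Finsupp.single x 1) = of φ x := by
  simp [combination]

theorem combination_apply (φ : E → X) (c : X →₀ ℝ) (f : LipBall φ) :
    (combination φ c).1 f = Finsupp.linearCombination ℝ f.1 c := by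
  let ev : ArensEells φ →ₗ[ℝ] ℝ :=
    { toFun := fun z => z.1 f
      map_add' := fun _ _ => rfl
      map_smul' := fun _ _ => rfl }
  change ev (combination φ c) = _
  rw [combination, Finsupp.apply_linearCombination]
  rfl

theorem denseRange_combination (φ : E → X) : DenseRange (combination φ) := by
  intro z
  have hz : (z.1 : lp (fun _ : LipBall φ => ℝ) ∞) ∈
      closure (Submodule.span ℝ (range (evalAt φ)) : Set (lp (fun _ : LipBall φ => ℝ) ∞)) := z.2
  rw [Metric.mem_closure_iff] at hz ⊢
  intro ε hε
  obtain ⟨b, hb, hd⟩ := hz ε hε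
  obtain ⟨c, rfl⟩ := (Finsupp.mem_span_range_iff_exists_finsupp).1 hb
  refine ⟨combination φ c, mem_range_self c, ?_⟩
  have : (combination φ c).1 = c.sum fun i a => a • evalAt φ i := by
    let co : ArensEells φ →ₗ[ℝ] lp (fun _ : LipBall φ => ℝ) ∞ := Submodule.subtype _
    change co (combination φ c) = _
    rw [combination, Finsupp.apply_linearCombination]
    rfl
  rw [← this] at hd
  exact hd

variable {F : Type v} [NormedAddCommGroup F] [NormedSpace ℝ F]

/-- The norm of the Arens-Eells space is the largest one for which Lipschitz maps that are linear
on `E` extend: by the Hahn-Banach theorem it is enough to look at real-valued maps. -/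
theorem norm_linearCombination_le {φ : E → X} {θ : X → F} {L : ℝ≥0} (hθ : LipschitzWith L θ)
    (hlin : IsLinearMap ℝ (θ ∘ φ)) (c : X →₀ ℝ) :
    ‖Finsupp.linearCombination ℝ θ c‖ ≤ L * ‖combination φ c‖ := by
  obtain ⟨g, hg, hgc⟩ := exists_dual_vector'' ℝ (Finsupp.linearCombination ℝ θ c)
  have hgθ : LipschitzWith L (g ∘ θ) := by
    refine LipschitzWith.of_dist_le_mul fun x y => ?_
    rw [Function.comp, Function.comp, dist_eq_norm, ← map_sub]
    refine (g.le_opNorm _).trans ?_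
    rw [← dist_eq_norm]
    exact (mul_le_of_le_one_left dist_nonneg hg).trans (hθ.dist_le_mul x y)
  have hgc' : Finsupp.linearCombination ℝ (g ∘ θ) c = ‖Finsupp.linearCombination ℝ θ c‖ := by
    have := Finsupp.apply_linearCombination ℝ g.toLinearMap θ c
    exact this.symm.trans hgc
  have hglin : IsLinearMap ℝ ((g ∘ θ) ∘ φ) := by
    have := (g.toLinearMap.comp (hlin.mk' _)).isLinear
    exact this
  rcases eq_or_ne L 0 with rfl | hL
  · have h0 : g ∘ θ = 0 := by
      funext x
      have h1 := hgθ.dist_le_mul x (φ 0)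
      have h2 : (g ∘ θ) (φ 0) = 0 := hglin.map_zero
      rw [h2, NNReal.coe_zero, zero_mul] at h1
      exact dist_le_zero.1 h1
    rw [← hgc', h0]
    simp
  · have hL' : (0 : ℝ) < L := by exact_mod_cast hL.bot_lt
    let f : LipBall φ := ⟨(L : ℝ)⁻¹ • (g ∘ θ), by
      refine LipschitzWith.of_dist_le_mul fun x y => ?_
      have := hgθ.dist_le_mul x y
      simp only [Pi.smul_apply, smul_eq_mul, Real.dist_eq] at this ⊢
      rw [← mul_sub, abs_mul, abs_of_pos (inv_pos.2 hL'), NNReal.coe_one, one_mul,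
        inv_mul_le_iff₀ hL']
      exact this, by
      have := ((L : ℝ)⁻¹ • hglin.mk' _).isLinear
      exact this⟩
    have h1 : |(combination φ c).1 f| ≤ ‖combination φ c‖ :=
      lp.norm_apply_le_norm ENNReal.top_ne_zero (combination φ c).1 f
    have h2 : Finsupp.linearCombination ℝ f.1 c =
        (L : ℝ)⁻¹ * Finsupp.linearCombination ℝ (g ∘ θ) c := by
      simp only [f, Finsupp.linearCombination_apply, Finsupp.sum, Pi.smul_apply, smul_eq_mul,
        Finset.mul_sum]
      exact Finset.sum_congr rfl fun i _ => by ring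
    rw [combination_apply, h2, hgc'] at h1
    have h3 := (le_abs_self _).trans h1
    rwa [inv_mul_le_iff₀ hL'] at h3

theorem continuousLinearMap_ext {φ : E → X} {S T : ArensEells φ →L[ℝ] F}
    (h : ∀ x, S (of φ x) = T (of φ x)) : S = T := by
  have h1 : (S : ArensEells φ → F) = T :=
    (denseRange_combination φ).equalizer S.continuous T.continuous <| by
      have h2 : S.toLinearMap ∘ₗ combination φ = T.toLinearMap ∘ₗ combination φ := by
        refine Finsupp.lhom_ext' fun x => LinearMap.ext_ring ?_
        simpa [combination] using h x
      exact congrArg DFunLike.coe h2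
  exact DFunLike.coe_injective h1

theorem exists_unique_extension [CompleteSpace F] {φ : E → X} {θ : X → F} {L : ℝ≥0}
    (hθ : LipschitzWith L θ) (hlin : IsLinearMap ℝ (θ ∘ φ)) :
    ∃ T : ArensEells φ →L[ℝ] F, ((∀ x, T (of φ x) = θ x) ∧ ‖T‖ ≤ L) ∧
      ∀ S : ArensEells φ →L[ℝ] F, (∀ x, S (of φ x) = θ x) → S = T := by
  have hb := norm_linearCombination_le hθ hlin
  have hT (x : X) : (Finsupp.linearCombination ℝ θ).extendOfNorm (combination φ) (of φ x) = θ x := by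
    rw [← combination_single, LinearMap.extendOfNorm_eq (denseRange_combination φ) ⟨L, hb⟩]
    simp
  refine ⟨_, ⟨hT, ?_⟩, fun S hS => continuousLinearMap_ext fun x => (hS x).trans (hT x).symm⟩
  exact ContinuousLinearMap.opNorm_le_bound _ L.2 fun z =>
    LinearMap.norm_extendOfNorm_apply_le (denseRange_combination φ) L hb z

end ArensEells

end ArensEells

/-! ### Convexity makes the canonical map isometric -/

section Prime

variable (E : Type u) [NormedAddCommGroup E] [NormedSpace ℝ E]

variable {E} in
/-- A linear functional with an affine translate below a Katětov function has norm at most `1`: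
it grows no faster than the norm. -/
theorem le_norm_of_add_le (ξ : Katetov E) (l : E →ₗ[ℝ] ℝ) (c : ℝ) (h : ∀ y, l y + c ≤ ξ y)
    (y : E) : l y ≤ ‖y‖ := by
  by_contra! hlt
  obtain ⟨n, hn⟩ := exists_nat_gt ((ξ 0 - c) / (l y - ‖y‖))
  rw [div_lt_iff₀ (by linarith)] at hn
  have h1 := h ((n : ℝ) • y)
  have h2 := (ξ.2 ((n : ℝ) • y) 0).1
  rw [dist_zero_right, norm_smul, Real.norm_natCast] at h2
  rw [map_smul, smul_eq_mul] at h1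
  nlinarith

variable {E} in
/-- For convex `ξ`, the difference of values at a point `x` is almost realised by a function of
`LipBall`: if `l` is the linear part of an affine minorant of `ξ` that almost touches it at
`x`, take the greatest extension of `-l`. -/
theorem KC0.apply_sub_le (ξ ζ : KC0 E) (x : E) :
    ξ.1 x - ζ.1 x ≤ ‖ArensEells.of (KC0.of E) ξ - ArensEells.of (KC0.of E) ζ‖ := by
  refine le_of_forall_pos_le_add fun ε hε => ?_
  have hcont : Continuous ξ.1.1 := by
    have : LipschitzWith 1 ξ.1.1 := LipschitzWith.of_le_add fun x y => (ξ.1.2 x y).1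
    exact this.continuous
  obtain ⟨l, c, hle, hx⟩ := ConvexOn.exists_affine_le_of_lt (𝕜 := ℝ) (mem_univ x)
    (show ξ.1 x - ε < ξ.1.1 x by linarith) isClosed_univ
    (hcont.lowerSemicontinuous.lowerSemicontinuousOn _) ξ.2.2
  have hle' (y : E) : l y + c ≤ ξ.1 y := hle ⟨y, mem_univ y⟩
  have hx' : l x + c = ξ.1 x - ε := hx
  have hl (y : E) : (-l.toLinearMap) y ≤ ‖y‖ := by
    have := le_norm_of_add_le ξ.1 l.toLinearMap c hle' (-y)
    rw [norm_neg, map_neg] at this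
    exact this
  obtain ⟨f, hf1, hf2⟩ := LipBall.mcShane (KC0.isometry_of E) (-l.toLinearMap) hl
  have h1 : c ≤ f.1 ξ := hf2 ξ c fun y => by
    have := hle' y
    rw [KC0.dist_of_right]
    change c ≤ ξ.1 y + -l y
    linarith
  have h2 : f.1 ζ ≤ ζ.1 x + -l x := by
    have := hf1 ζ x
    rwa [KC0.dist_of_right] at this
  have h3 := ArensEells.sub_le_norm_of_sub (KC0.of E) f ξ ζ
  linarith

theorem KC0.isometry_arensEells_of : Isometry (ArensEells.of (KC0.of E)) := by
  refine Isometry.of_dist_eq fun ξ ζ => ?_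
  rw [dist_eq_norm]
  refine le_antisymm (ArensEells.norm_of_sub_le _ ξ ζ) ?_
  refine Katetov.dist_le_of_forall (norm_nonneg _) fun x => abs_le.2 ⟨?_, KC0.apply_sub_le ξ ζ x⟩
  have := KC0.apply_sub_le ζ ξ x
  rw [norm_sub_rev] at this
  linarith

theorem Prime.isArensEells :
    IsArensEells.{u, w} (KC0.of E) (Prime E) (ArensEells.of (KC0.of E)) where
  complete := inferInstance
  isometry := KC0.isometry_arensEells_of E
  isLinearMap := ArensEells.isLinearMap_of _
  extend _ _ _ _ _ _ hθ hlin := ArensEells.exists_unique_extension hθ hlin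

variable {E} in
theorem Prime.norm_of_sub_incl (ξ : KC0 E) (a : E) :
    ‖ArensEells.of (KC0.of E) ξ - Prime.incl E a‖ = ξ.1 a := by
  rw [← dist_eq_norm]
  exact ((KC0.isometry_arensEells_of E).dist_eq ξ (KC0.of E a)).trans (KC0.dist_of_right ξ a)

end Prime

/-! ### Extension by one dimension -/

section OneStep

variable {G : Type u} [NormedAddCommGroup G] [NormedSpace ℝ G]
  {F : Type v} [NormedAddCommGroup F] [NormedSpace ℝ F]

/-- The Katětov function on `G` of a virtual point with distance about `‖x - v‖` to `T x`, for
`x` in `W`. The factor `c` exceeds the norm of `T` on `W`. This makes the function Katětov, and it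
confines the infimum to a ball of `W`, which is compact if `W` has finite dimension. -/
def virtualPoint (T : F →ₗ[ℝ] G) (W : Submodule ℝ F) (v : F) (c : ℝ) (z : G) : ℝ :=
  ⨅ x : W, (‖z - T x‖ + c * ‖(x : F) - v‖)

variable {T : F →ₗ[ℝ] G} {W : Submodule ℝ F} {v : F} {a b c : ℝ}

theorem virtualPoint_le (hc : 0 ≤ c) (z : G) (x : W) :
    virtualPoint T W v c z ≤ ‖z - T x‖ + c * ‖(x : F) - v‖ :=
  ciInf_le ⟨0, by rintro _ ⟨y, rfl⟩; positivity⟩ x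

theorem exists_lt_virtualPoint_add (z : G) {ε : ℝ} (hε : 0 < ε) :
    ∃ x : W, ‖z - T x‖ + c * ‖(x : F) - v‖ < virtualPoint T W v c z + ε :=
  exists_lt_of_ciInf_lt (show (⨅ _ : W, _) < _ from lt_add_of_pos_right _ hε)

theorem isKatetov_virtualPoint (hc : 0 ≤ c) (hT : ∀ x ∈ W, ‖T x‖ ≤ c * ‖x‖) :
    IsKatetov (virtualPoint T W v c) := by
  refine fun z z' => ⟨?_, ?_⟩ <;> refine le_of_forall_pos_le_add fun ε hε => ?_
  · obtain ⟨x, hx⟩ := exists_lt_virtualPoint_add (T := T) (W := W) (v := v) (c := c) z' hε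
    have h1 := virtualPoint_le (T := T) (v := v) hc z x
    have h2 := norm_sub_le_norm_sub_add_norm_sub z z' (T x)
    rw [dist_eq_norm]
    linarith
  · obtain ⟨x, hx⟩ :=
      exists_lt_virtualPoint_add (T := T) (W := W) (v := v) (c := c) z (half_pos hε)
    obtain ⟨y, hy⟩ :=
      exists_lt_virtualPoint_add (T := T) (W := W) (v := v) (c := c) z' (half_pos hε)
    have h1 := hT (x - y) (W.sub_mem x.2 y.2)
    have h2 : c * ‖(x : F) - y‖ ≤ c * ‖(x : F) - v‖ + c * ‖(y : F) - v‖ := by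
      rw [← mul_add, norm_sub_rev (y : F) v]
      exact mul_le_mul_of_nonneg_left (norm_sub_le_norm_sub_add_norm_sub _ _ _) hc
    have h3 := dist_triangle4 z (T x) (T y) z'
    rw [map_sub] at h1
    rw [dist_eq_norm z (T x), dist_eq_norm (T x), dist_comm (T y) z',
      dist_eq_norm z'] at h3
    linarith

theorem convexOn_virtualPoint (hc : 0 ≤ c) : ConvexOn ℝ univ (virtualPoint T W v c) := by
  refine ⟨convex_univ, fun z _ z' _ s t hs ht hst => le_of_forall_pos_le_add fun ε hε => ?_⟩
  obtain ⟨x, hx⟩ := exists_lt_virtualPoint_add (T := T) (W := W) (v := v) (c := c) z hε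
  obtain ⟨y, hy⟩ := exists_lt_virtualPoint_add (T := T) (W := W) (v := v) (c := c) z' hε
  have h1 := virtualPoint_le (T := T) (v := v) hc (s • z + t • z') (s • x + t • y)
  have h2 : ‖s • z + t • z' - T ↑(s • x + t • y)‖ ≤ s * ‖z - T x‖ + t * ‖z' - T y‖ := by
    have : s • z + t • z' - T ↑(s • x + t • y) = s • (z - T x) + t • (z' - T y) := by
      simp only [Submodule.coe_add, Submodule.coe_smul, map_add, map_smul]
      module
    rw [this]
    refine (norm_add_le _ _).trans_eq ?_
    rw [norm_smul, norm_smul, Real.norm_of_nonneg hs, Real.norm_of_nonneg ht]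
  have h3 : ‖(↑(s • x + t • y) : F) - v‖ ≤ s * ‖(x : F) - v‖ + t * ‖(y : F) - v‖ := by
    have : (↑(s • x + t • y) : F) - v = s • ((x : F) - v) + t • ((y : F) - v) := by
      simp only [Submodule.coe_add, Submodule.coe_smul]
      nth_rewrite 1 [← one_smul ℝ v]
      rw [← hst]
      module
    rw [this]
    refine (norm_add_le _ _).trans_eq ?_
    rw [norm_smul, norm_smul, Real.norm_of_nonneg hs, Real.norm_of_nonneg ht]
  have h4 := mul_le_mul_of_nonneg_left h3 hc
  have h5 := mul_le_mul_of_nonneg_left hx.le hs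
  have h6 := mul_le_mul_of_nonneg_left hy.le ht
  have h7 : s * ε + t * ε = ε := by rw [← add_mul, hst, one_mul]
  simp only [smul_eq_mul]
  linarith

/-- Points of `W` of large norm do not matter for the infimum in `virtualPoint`, since the norm of
`T` on `W` is less than `c`. -/
theorem exists_norm_le_and_norm_sub_add_le (hbc : b < c) (hc : 0 ≤ c)
    (hT : ∀ x ∈ W, ‖T x‖ ≤ b * ‖x‖) (z : G) (x : W) : ∃ y : W, ‖y‖ ≤ 2 * c * ‖v‖ / (c - b) ∧
      ‖z - T y‖ + c * ‖(y : F) - v‖ ≤ ‖z - T x‖ + c * ‖(x : F) - v‖ := by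
  have hcb : 0 < c - b := sub_pos.2 hbc
  rcases le_or_gt ‖x‖ (2 * c * ‖v‖ / (c - b)) with h | h
  · exact ⟨x, h, le_rfl⟩
  · refine ⟨0, by rw [norm_zero]; positivity, ?_⟩
    rw [div_lt_iff₀ hcb, Submodule.coe_norm] at h
    have h1 := norm_sub_norm_le z (T x)
    have h2 := hT x x.2
    have h3 := mul_le_mul_of_nonneg_left (norm_sub_norm_le (x : F) v) hc
    simp only [Submodule.coe_zero, map_zero, sub_zero, zero_sub, norm_neg]
    linarith

theorem virtualPoint_mem_katetovZero [FiniteDimensional ℝ F] (hb : 0 ≤ b) (hbc : b < c)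
    (hT : ∀ x ∈ W, ‖T x‖ ≤ b * ‖x‖) (hK : IsKatetov (virtualPoint T W v c)) :
    (⟨virtualPoint T W v c, hK⟩ : Katetov G) ∈ katetovZero G := by
  have hc : 0 < c := hb.trans_lt hbc
  refine mem_katetovZero_iff.2 fun ε hε => ?_
  obtain ⟨S, hSf, hS⟩ := Metric.totallyBounded_iff.1
    (isCompact_closedBall (0 : W) (2 * c * ‖v‖ / (c - b))).totallyBounded
    (ε / 2 / (b + c)) (by positivity)
  refine ⟨(fun x : W => T x) '' S, hSf.image _, fun z => ?_⟩
  obtain ⟨x, hx⟩ :=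
    exists_lt_virtualPoint_add (T := T) (W := W) (v := v) (c := c) z (half_pos hε)
  obtain ⟨x', hx'R, hx'⟩ := exists_norm_le_and_norm_sub_add_le (v := v) hbc hc.le hT z x
  obtain ⟨y, hy, hxy⟩ := mem_iUnion₂.1 (hS (mem_closedBall_zero_iff.2 hx'R))
  refine ⟨T y, mem_image_of_mem _ hy, ?_⟩
  have h1 := virtualPoint_le (T := T) (v := v) hc.le (T y) y
  have h2 := norm_sub_le_norm_sub_add_norm_sub z (T x') (T y)
  have h3 := hT (x' - y) (W.sub_mem x'.2 y.2)
  have h4 := mul_le_mul_of_nonneg_left (norm_sub_le_norm_sub_add_norm_sub (y : F) x' v) hc.le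
  rw [map_sub] at h3
  rw [norm_sub_rev (y : F) x'] at h4
  rw [Metric.mem_ball, dist_eq_norm, Submodule.coe_norm, lt_div_iff₀ (by positivity),
    Submodule.coe_sub] at hxy
  rw [sub_self, norm_zero, zero_add] at h1
  rw [dist_eq_norm]
  change ‖z - T y‖ + virtualPoint T W v c (T y) ≤ virtualPoint T W v c z + ε
  linarith

/-- A linear map on `W` with bounds `a` and `b` extends to one more vector `v` at the cost of
enlarging `b`: send `v` to the virtual point, which belongs to `G'`. -/
theorem Prime.exists_extension_sup_span_singleton [FiniteDimensional ℝ F] (hab : a ≤ b)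
    (hb : 0 ≤ b) (hbc : b < c) (hT : ∀ x ∈ W, a * ‖x‖ ≤ ‖T x‖ ∧ ‖T x‖ ≤ b * ‖x‖) (v : F) :
    ∃ S : F →ₗ[ℝ] Prime G, (∀ x ∈ W, S x = Prime.incl G (T x)) ∧
      ∀ x ∈ W ⊔ Submodule.span ℝ {v}, a * ‖x‖ ≤ ‖S x‖ ∧ ‖S x‖ ≤ c * ‖x‖ := by
  have hc : 0 < c := hb.trans_lt hbc
  have hTc (x : F) (hx : x ∈ W) : ‖T x‖ ≤ c * ‖x‖ :=
    (hT x hx).2.trans (mul_le_mul_of_nonneg_right hbc.le (norm_nonneg x))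
  by_cases hv : v ∈ W
  · refine ⟨(Prime.incl G).toLinearMap ∘ₗ T, fun _ _ => rfl, fun x hx => ?_⟩
    rw [sup_eq_left.2 ((Submodule.span_singleton_le_iff_mem v W).2 hv)] at hx
    have : ‖((Prime.incl G).toLinearMap ∘ₗ T) x‖ = ‖T x‖ := (Prime.incl G).norm_map _
    rw [this]
    exact ⟨(hT x hx).1, hTc x hx⟩
  have hK : IsKatetov (virtualPoint T W v c) := isKatetov_virtualPoint hc.le hTc
  let ξ : KC0 G := ⟨⟨virtualPoint T W v c, hK⟩,
    virtualPoint_mem_katetovZero hb hbc (fun x hx => (hT x hx).2) hK, convexOn_virtualPoint hc.le⟩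
  let w : Prime G := ArensEells.of (KC0.of G) ξ
  have hw (x : F) (hx : x ∈ W) :
      a * ‖x - v‖ ≤ ‖w - Prime.incl G (T x)‖ ∧ ‖w - Prime.incl G (T x)‖ ≤ c * ‖x - v‖ := by
    rw [Prime.norm_of_sub_incl]
    change _ ≤ virtualPoint T W v c (T x) ∧ virtualPoint T W v c (T x) ≤ _
    constructor
    · refine le_ciInf fun y => ?_
      have h1 := (hT (x - y) (W.sub_mem hx y.2)).1
      rw [map_sub] at h1
      rcases le_or_gt a 0 with ha | ha
      · exact (mul_nonpos_of_nonpos_of_nonneg ha (norm_nonneg _)).trans (by positivity)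
      · have h2 := mul_le_mul_of_nonneg_left (norm_sub_le_norm_sub_add_norm_sub x y v) ha.le
        have h3 := mul_le_mul_of_nonneg_right (hab.trans hbc.le) (norm_nonneg ((y : F) - v))
        linarith
    · simpa using virtualPoint_le (T := T) (v := v) hc.le (T x) ⟨x, hx⟩
  obtain ⟨f, hfv, hfW⟩ := Submodule.exists_le_ker_of_notMem hv
  let S : F →ₗ[ℝ] Prime G := (Prime.incl G).toLinearMap ∘ₗ T +
    f.smulRight ((f v)⁻¹ • (w - Prime.incl G (T v)))
  have hSW (x : F) (hx : x ∈ W) : S x = Prime.incl G (T x) := by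
    have : f x = 0 := hfW hx
    simp [S, this]
  have hSv : S v = w := by
    simp [S, smul_smul, mul_inv_cancel₀ hfv]
  refine ⟨S, hSW, fun x hx => ?_⟩
  obtain ⟨y, hy, u, hu, rfl⟩ := Submodule.mem_sup.1 hx
  obtain ⟨r, rfl⟩ := Submodule.mem_span_singleton.1 hu
  rcases eq_or_ne r 0 with rfl | hr
  · rw [zero_smul, add_zero, hSW y hy, LinearIsometry.norm_map]
    exact ⟨(hT y hy).1, hTc y hy⟩
  · have h1 : S (y + r • v) = r • (w - Prime.incl G (T (-(r⁻¹ • y)))) := by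
      rw [map_add, map_smul, hSW y hy, hSv, map_neg, map_neg, map_smul, map_smul, smul_sub,
        smul_neg, smul_smul, mul_inv_cancel₀ hr, one_smul]
      abel
    have h2 : y + r • v = -r • (-(r⁻¹ • y) - v) := by
      rw [neg_smul, smul_sub, smul_neg, smul_smul, mul_inv_cancel₀ hr, one_smul]
      abel
    have h3 := hw (-(r⁻¹ • y)) (W.neg_mem (W.smul_mem _ hy))
    rw [h1, h2, norm_smul, norm_smul, norm_neg]
    have h4 := norm_nonneg r
    constructor
    · nlinarith [h3.1]
    · nlinarith [h3.2]

end OneStep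

/-! ### The extension property of the limit -/

section Extension

theorem SeqLimit.of_succ {G : ℕ → Type u} [∀ n, NormedAddCommGroup (G n)]
    [∀ n, NormedSpace ℝ (G n)] (j : ∀ n, G n →ₗᵢ[ℝ] G (n + 1)) (n : ℕ) (x : G n) :
    SeqLimit.of j (n + 1) (j n x) = SeqLimit.of j n x := by
  have h := SeqUnion.of_seqMap j n (n + 1) n.le_succ x
  rw [seqMap_succ j n n le_rfl, seqMap_self] at h
  exact congrArg (fun z : SeqUnion j => (z : SeqLimit j)) h

theorem SeqLimit.monotone_range_of {G : ℕ → Type u} [∀ n, NormedAddCommGroup (G n)]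
    [∀ n, NormedSpace ℝ (G n)] (j : ∀ n, G n →ₗᵢ[ℝ] G (n + 1)) :
    Monotone fun n => range (SeqLimit.of j n) :=
  monotone_nat_of_le_succ fun n => by
    rintro _ ⟨x, rfl⟩
    exact ⟨j n x, SeqLimit.of_succ j n x⟩

theorem SeqLimit.dense_iUnion_range_of {G : ℕ → Type u} [∀ n, NormedAddCommGroup (G n)]
    [∀ n, NormedSpace ℝ (G n)] (j : ∀ n, G n →ₗᵢ[ℝ] G (n + 1)) :
    Dense (⋃ n, range (SeqLimit.of j n)) := by
  refine UniformSpace.Completion.denseRange_coe.mono ?_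
  rintro _ ⟨z, rfl⟩
  obtain ⟨n, x, rfl⟩ := SeqUnion.exists_of j z
  exact mem_iUnion.2 ⟨n, x, rfl⟩

/-- A linear map of a finite-dimensional space into the limit is approximated by linear maps into
the spaces of the chain. -/
theorem SeqLimit.exists_linearMap_approx {G : ℕ → Type u} [∀ n, NormedAddCommGroup (G n)]
    [∀ n, NormedSpace ℝ (G n)] (j : ∀ n, G n →ₗᵢ[ℝ] G (n + 1)) {V : Type v}
    [NormedAddCommGroup V] [NormedSpace ℝ V] [FiniteDimensional ℝ V] (ψ : V →ₗ[ℝ] SeqLimit j)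
    {ε : ℝ} (hε : 0 < ε) :
    ∃ n, ∃ T : V →ₗ[ℝ] G n, ∀ x, ‖ψ x - SeqLimit.of j n (T x)‖ ≤ ε * ‖x‖ := by
  let B := Module.finBasis ℝ V
  let C : ℝ := ∑ i, ‖(LinearMap.toContinuousLinearMap (B.coord i))‖
  have hC : 0 ≤ C := Finset.sum_nonneg fun _ _ => norm_nonneg _
  have hδ : 0 < ε / (C + 1) := by positivity
  have happ (i) : ∃ n, ∃ y : G n, ‖ψ (B i) - SeqLimit.of j n y‖ < ε / (C + 1) := by
    obtain ⟨z, hz, hd⟩ := Metric.mem_closure_iff.1 (SeqLimit.dense_iUnion_range_of j (ψ (B i))) _ hδ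
    obtain ⟨n, y, rfl⟩ := mem_iUnion.1 hz
    rw [dist_eq_norm] at hd
    exact ⟨n, y, hd⟩
  choose k y hy using happ
  let n := Finset.univ.sup k
  have hn (i) : ∃ y' : G n, SeqLimit.of j n y' = SeqLimit.of j (k i) (y i) :=
    SeqLimit.monotone_range_of j (Finset.le_sup (Finset.mem_univ i)) (mem_range_self (y i))
  choose y' hy' using hn
  refine ⟨n, B.constr ℝ y', fun x => ?_⟩
  have h1 : ψ x - SeqLimit.of j n (B.constr ℝ y' x) =
      ∑ i, B.coord i x • (ψ (B i) - SeqLimit.of j (k i) (y i)) := by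
    nth_rewrite 1 [← B.sum_repr x]
    rw [B.constr_apply_fintype ℝ, map_sum, map_sum, ← Finset.sum_sub_distrib]
    refine Finset.sum_congr rfl fun i _ => ?_
    rw [map_smul, map_smul, hy', smul_sub]
    rfl
  rw [h1]
  calc _ ≤ ∑ i, ‖B.coord i x • (ψ (B i) - SeqLimit.of j (k i) (y i))‖ := norm_sum_le _ _
    _ ≤ ∑ i, ‖LinearMap.toContinuousLinearMap (B.coord i)‖ * ‖x‖ * (ε / (C + 1)) := by
        refine Finset.sum_le_sum fun i _ => ?_
        rw [norm_smul]
        exact mul_le_mul ((LinearMap.toContinuousLinearMap (B.coord i)).le_opNorm x) (hy i).le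
          (norm_nonneg _) (by positivity)
    _ = C * (ε / (C + 1)) * ‖x‖ := by
        rw [← Finset.sum_mul, ← Finset.sum_mul]
        ring
    _ ≤ ε * ‖x‖ := by
        refine mul_le_mul_of_nonneg_right ?_ (norm_nonneg x)
        rw [mul_div_assoc', div_le_iff₀ (by positivity)]
        nlinarith

variable (E : Type u) [NormedAddCommGroup E] [NormedSpace ℝ E] [CompleteSpace E]

variable {E} in
/-- Iteration of the extension by one dimension. The upper bound grows by an arbitrarily small
amount in each step. -/
theorem Omega.exists_extension_sup_span {F : Type v} [NormedAddCommGroup F] [NormedSpace ℝ F]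
    [FiniteDimensional ℝ F] {W : Submodule ℝ F} {n : ℕ} {T : F →ₗ[ℝ] (chain E n).carrier}
    {a b : ℝ} (hab : a ≤ b) (hb : 0 ≤ b) (hT : ∀ x ∈ W, a * ‖x‖ ≤ ‖T x‖ ∧ ‖T x‖ ≤ b * ‖x‖)
    (s : Finset F) : ∀ c > b, ∃ m, ∃ S : F →ₗ[ℝ] (chain E m).carrier,
      (∀ x ∈ W, SeqLimit.of (chainIncl E) m (S x) = SeqLimit.of (chainIncl E) n (T x)) ∧
      ∀ x ∈ W ⊔ Submodule.span ℝ (s : Set F), a * ‖x‖ ≤ ‖S x‖ ∧ ‖S x‖ ≤ c * ‖x‖ := by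
  classical
  induction s using Finset.induction_on with
  | empty =>
    refine fun c hc => ⟨n, T, fun _ _ => rfl, fun x hx => ?_⟩
    rw [Finset.coe_empty, Submodule.span_empty, sup_bot_eq] at hx
    exact ⟨(hT x hx).1, (hT x hx).2.trans (mul_le_mul_of_nonneg_right hc.le (norm_nonneg x))⟩
  | insert v s _ ih =>
    intro c hc
    obtain ⟨c', hbc', hc'⟩ := exists_between hc
    obtain ⟨m, S, hST, hS⟩ := ih c' hbc'
    obtain ⟨S', hSS', hS'⟩ := Prime.exists_extension_sup_span_singleton (hab.trans hbc'.le)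
      (hb.trans hbc'.le) hc' hS v
    refine ⟨m + 1, S', fun x hx => ?_, ?_⟩
    · rw [← hST x hx, ← SeqLimit.of_succ (chainIncl E) m]
      exact congrArg (SeqLimit.of (chainIncl E) (m + 1)) (hSS' x (Submodule.mem_sup_left hx))
    · rw [Finset.coe_insert, Submodule.span_insert, sup_comm (Submodule.span ℝ {v}), ← sup_assoc]
      exact hS'

/-- The approximate extension property. An isometric embedding `ψ` of `F₀` is approximated by a
map into a space of the chain, which is extended to `F`; a small linear correction, through a
projection of `F` onto `F₀`, makes the result extend `ψ` itself. -/
theorem Omega.hasApproxExtension : HasApproxExtension.{u, v} (Omega E) := by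
  intro ε₀ hε₀ F _ _ _ F₀ ψ
  obtain ⟨p, hp⟩ := F₀.subtype.exists_leftInverse_of_injective F₀.ker_subtype
  have hpx (x : F₀) : p x = x := LinearMap.congr_fun hp x
  let C : ℝ := ‖LinearMap.toContinuousLinearMap p‖
  have hC : 0 ≤ C := norm_nonneg (LinearMap.toContinuousLinearMap p)
  have hpC (x : F) : ‖p x‖ ≤ C * ‖x‖ := (LinearMap.toContinuousLinearMap p).le_opNorm x
  -- Injectivity comes from the lower bound, so `ε` has to be less than `1`.
  let ε : ℝ := min ε₀ (1 / 2)
  have hε : 0 < ε := lt_min hε₀ (by norm_num)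
  obtain ⟨δ, hδ, hδC⟩ : ∃ δ : ℝ, 0 < δ ∧ δ * C + 2 * δ = ε :=
    ⟨ε / (C + 2), by positivity, by field_simp⟩
  obtain ⟨n, T, hT⟩ := SeqLimit.exists_linearMap_approx (chainIncl E) ψ.toLinearMap hδ
  have hTb : ∀ x ∈ F₀, (1 - δ) * ‖x‖ ≤ ‖(T ∘ₗ p) x‖ ∧ ‖(T ∘ₗ p) x‖ ≤ (1 + δ) * ‖x‖ := by
    intro x hx
    have h1 := hT ⟨x, hx⟩
    have h2 := abs_le.1 ((abs_norm_sub_norm_le _ _).trans h1)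
    have h3 : ‖ψ.toLinearMap ⟨x, hx⟩‖ = ‖x‖ := ψ.norm_map _
    rw [h3, LinearIsometry.norm_map, Submodule.coe_norm] at h2
    rw [LinearMap.comp_apply, hpx ⟨x, hx⟩]
    constructor <;> linarith [h2.1, h2.2]
  obtain ⟨s, hs⟩ := Module.finite_def.1 (inferInstance : FiniteDimensional ℝ F)
  obtain ⟨m, S, hST, hS⟩ := Omega.exists_extension_sup_span (by linarith) (by linarith) hTb s
    (1 + 2 * δ) (by linarith)
  rw [hs, sup_top_eq] at hS
  let D : F →ₗ[ℝ] Omega E :=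
    (ψ.toLinearMap - (SeqLimit.of (chainIncl E) n).toLinearMap ∘ₗ T) ∘ₗ p
  have hD (x : F) : ‖D x‖ ≤ δ * C * ‖x‖ := by
    have h1 := mul_le_mul_of_nonneg_left (hpC x) hδ.le
    exact (hT (p x)).trans (by linarith)
  let φ : F →ₗ[ℝ] Omega E := (SeqLimit.of (chainIncl E) m).toLinearMap ∘ₗ S + D
  have hφ (x : F) : (1 - ε) * ‖x‖ ≤ ‖φ x‖ ∧ ‖φ x‖ ≤ (1 + ε) * ‖x‖ := by
    have h1 := hS x Submodule.mem_top
    have h2 : ‖SeqLimit.of (chainIncl E) m (S x)‖ = ‖S x‖ := LinearIsometry.norm_map _ _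
    have h3 : φ x = SeqLimit.of (chainIncl E) m (S x) + D x := rfl
    have h4 := norm_add_le (SeqLimit.of (chainIncl E) m (S x)) (D x)
    have h5 := norm_sub_le_norm_add (SeqLimit.of (chainIncl E) m (S x)) (D x)
    have h6 := mul_nonneg hδ.le (norm_nonneg x)
    rw [← h3] at h4 h5
    rw [← hδC]
    constructor <;> linarith [h1.1, h1.2, hD x]
  have hε₁ : ε ≤ 1 / 2 := min_le_right _ _
  have hε₂ : ε ≤ ε₀ := min_le_left _ _
  refine ⟨φ, (injective_iff_map_eq_zero φ).2 fun x hx => ?_, fun x => ?_, fun x => ⟨?_, ?_⟩⟩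
  · have h := (hφ x).1
    rw [hx, norm_zero] at h
    exact norm_le_zero_iff.1 (nonpos_of_mul_nonpos_right h (by linarith))
  · change SeqLimit.of (chainIncl E) m (S x) +
      (ψ (p x) - SeqLimit.of (chainIncl E) n (T (p x))) = ψ x
    rw [hST x x.2, LinearMap.comp_apply, hpx]
    abel
  · exact (mul_le_mul_of_nonneg_right (by linarith) (norm_nonneg x)).trans (hφ x).1
  · exact (hφ x).2.trans (mul_le_mul_of_nonneg_right (by linarith) (norm_nonneg x))

end Extension

/-! ### Weight and density -/

section Weight

open Cardinal

/-- The density character of `X` is at most `κ`. -/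
def DensityLE (X : Type u) [TopologicalSpace X] (κ : Cardinal.{u}) : Prop :=
  ∃ s : Set X, Dense s ∧ #s ≤ κ

theorem densityLE_weight (X : Type u) [TopologicalSpace X] : DensityLE X (weight X) := by
  have : Nonempty {B : Set (Set X) // TopologicalSpace.IsTopologicalBasis B} :=
    ⟨⟨_, TopologicalSpace.isTopologicalBasis_opens⟩⟩
  obtain ⟨⟨B, hB⟩, hBw⟩ := ciInf_mem
    fun B : {B : Set (Set X) // TopologicalSpace.IsTopologicalBasis B} => #B.1
  let f : {b : B // b.1.Nonempty} → X := fun b => b.2.choose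
  refine ⟨range f, hB.dense_iff.2 fun b hb hne => ?_, ?_⟩
  · exact ⟨f ⟨⟨b, hb⟩, hne⟩, Exists.choose_spec hne, mem_range_self _⟩
  · exact mk_range_le.trans ((mk_subtype_le _).trans hBw.le)

theorem DensityLE.weight_le {X : Type u} [MetricSpace X] {κ : Cardinal.{u}} (hκ : ℵ₀ ≤ κ)
    (h : DensityLE X κ) : weight X ≤ κ := by
  obtain ⟨s, hs, hsκ⟩ := h
  let f : s × ℕ → Set X := fun p => Metric.ball p.1 (1 / (p.2 + 1))
  have hf : TopologicalSpace.IsTopologicalBasis (range f) := by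
    refine TopologicalSpace.isTopologicalBasis_of_isOpen_of_nhds ?_ fun x U hx hU => ?_
    · rintro _ ⟨p, rfl⟩
      exact Metric.isOpen_ball
    · obtain ⟨ε, hε, hεU⟩ := Metric.isOpen_iff.1 hU x hx
      obtain ⟨n, hn⟩ := exists_nat_one_div_lt (half_pos hε)
      obtain ⟨y, hy, hxy⟩ := hs.exists_dist_lt x (Nat.one_div_pos_of_nat (α := ℝ) (n := n))
      refine ⟨_, mem_range_self ((⟨y, hy⟩ : s), n), hxy, fun z hz => hεU ?_⟩
      have hz' : dist z y < 1 / (n + 1) := hz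
      have := dist_triangle_right z x y
      rw [Metric.mem_ball]
      linarith
  refine (ciInf_le' _ ⟨range f, hf⟩).trans (mk_range_le.trans ?_)
  rw [mk_prod, mk_nat, lift_aleph0, lift_id'.{0, u}]
  exact mul_le_of_le hκ hsκ hκ

theorem weight_le_of_isInducing {X Y : Type u} [TopologicalSpace X] [TopologicalSpace Y]
    {f : X → Y} (hf : IsInducing f) : weight X ≤ weight Y := by
  have : Nonempty {B : Set (Set Y) // TopologicalSpace.IsTopologicalBasis B} :=
    ⟨⟨_, TopologicalSpace.isTopologicalBasis_opens⟩⟩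
  refine le_ciInf fun B => ?_
  exact (ciInf_le' _ ⟨_, B.2.isInducing hf⟩).trans mk_image_le

/-- In a `T0` space a point is determined by the members of a base that contain it, so a finite base
leaves room for finitely many points only. -/
theorem aleph0_le_weight (X : Type u) [TopologicalSpace X] [T0Space X] [Infinite X] :
    ℵ₀ ≤ weight X := by
  have : Nonempty {B : Set (Set X) // TopologicalSpace.IsTopologicalBasis B} :=
    ⟨⟨_, TopologicalSpace.isTopologicalBasis_opens⟩⟩
  refine le_ciInf fun B => ?_
  rw [aleph0_le_mk_iff]
  by_contra hfin
  rw [not_infinite_iff_finite] at hfin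
  have hinj : Function.Injective fun x : X => {b : B.1 | x ∈ b.1} := by
    intro x y hxy
    refine TopologicalSpace.IsTopologicalBasis.eq_iff B.2 |>.2 fun b hb => ?_
    exact Set.ext_iff.1 hxy ⟨b, hb⟩
  exact not_finite_iff_infinite.2 ‹Infinite X› (Finite.of_injective _ hinj)

/-- A metric space whose points are described, with any given precision, by codes from a set of
cardinality at most `κ` has density character at most `κ`. -/
theorem DensityLE.of_codes {X : Type u} [MetricSpace X] {κ : Cardinal.{u}} (hκ : ℵ₀ ≤ κ)
    {C : Type u} (hC : #C ≤ κ) (R : ℝ → C → X → Prop) (hR : ∀ ε > 0, ∀ x, ∃ t, R ε t x)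
    (hd : ∀ ε t x y, R ε t x → R ε t y → dist x y ≤ ε) : DensityLE X κ := by
  let f : {p : ℕ × C // ∃ x, R (1 / (p.1 + 1)) p.2 x} → X := fun p => p.2.choose
  refine ⟨range f, Metric.dense_iff.2 fun x ε hε => ?_, mk_range_le.trans
    ((mk_subtype_le _).trans ?_)⟩
  · obtain ⟨n, hn⟩ := exists_nat_one_div_lt hε
    obtain ⟨t, ht⟩ := hR (1 / (n + 1)) Nat.one_div_pos_of_nat x
    have hex : ∃ x, R (1 / (n + 1)) t x := ⟨x, ht⟩
    exact ⟨f ⟨(n, t), hex⟩, (hd _ _ _ _ hex.choose_spec ht).trans_lt hn, mem_range_self _⟩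
  · rw [mk_prod, mk_nat, lift_aleph0, lift_id'.{0, u}]
    exact mul_le_of_le hκ hκ hC

theorem mk_list_prod_rat_le {X : Type u} {κ : Cardinal.{u}} (hκ : ℵ₀ ≤ κ) (hX : #X ≤ κ) :
    #(List (X × ℚ)) ≤ κ := by
  refine (mk_list_le_max _).trans (max_le hκ ?_)
  rw [mk_prod, Cardinal.mkRat, lift_aleph0, lift_id'.{0, u}]
  exact mul_le_of_le hκ hX hκ

/-- A function in `K₀(E)` is described, with given precision, by finitely many points of a dense
set and rational approximations of its values there. -/
theorem KC0.densityLE {E : Type u} [NormedAddCommGroup E] [NormedSpace ℝ E] {κ : Cardinal.{u}}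
    (hκ : ℵ₀ ≤ κ) (h : DensityLE E κ) : DensityLE (KC0 E) κ := by
  obtain ⟨s, hs, hsκ⟩ := h
  refine DensityLE.of_codes hκ (mk_list_prod_rat_le hκ hsκ)
    (fun ε t ξ => (∀ x, ∀ p ∈ t, ξ.1 x ≤ dist x p.1 + p.2 + ε / 2) ∧
      ∀ x, ∃ p ∈ t, dist x (p.1 : E) + p.2 ≤ ξ.1 x + ε / 2) (fun ε hε ξ => ?_) ?_
  · obtain ⟨Y, hYf, hY⟩ := mem_katetovZero_iff.1 ξ.2.1 (ε / 4) (by positivity)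
    have hδ : 0 < ε / 8 := by positivity
    have happ (y : E) : ∃ p : s × ℚ, dist y p.1 < ε / 8 ∧ |ξ.1 y - p.2| < ε / 8 := by
      obtain ⟨d, hd, hyd⟩ := hs.exists_dist_lt y hδ
      obtain ⟨q, hq⟩ := exists_rat_near (ξ.1 y) hδ
      exact ⟨(⟨d, hd⟩, q), hyd, hq⟩
    choose p hp hpq using happ
    refine ⟨hYf.toFinset.toList.map p, fun x q hq => ?_, fun x => ?_⟩
    · obtain ⟨y, -, rfl⟩ := List.mem_map.1 hq
      have h1 := (ξ.1.2 x y).1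
      have h2 := dist_triangle_right x y (p y).1
      have h3 := hp y
      have h4 := (abs_lt.1 (hpq y)).2
      linarith
    · obtain ⟨y, hy, hxy⟩ := hY x
      refine ⟨p y, List.mem_map.2 ⟨y, by simpa using hy, rfl⟩, ?_⟩
      have h2 := dist_triangle x y (p y).1
      have h3 := hp y
      have h4 := (abs_lt.1 (hpq y)).1
      linarith
  · rintro ε t ξ ζ ⟨hξ, hξ'⟩ ⟨hζ, hζ'⟩
    have hε : 0 ≤ ε := by
      obtain ⟨p, hp, hxp⟩ := hξ' 0
      have := hξ 0 p hp
      linarith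
    refine Katetov.dist_le_of_forall hε fun x => abs_le.2 ⟨?_, ?_⟩
    · obtain ⟨p, hp, hxp⟩ := hξ' x
      have := hζ x p hp
      linarith
    · obtain ⟨p, hp, hxp⟩ := hζ' x
      have := hξ x p hp
      linarith

theorem ArensEells.densityLE {E : Type u} [NormedAddCommGroup E] [NormedSpace ℝ E] {X : Type u}
    [MetricSpace X] (φ : E → X) {κ : Cardinal.{u}} (hκ : ℵ₀ ≤ κ) (h : DensityLE X κ) :
    DensityLE (ArensEells φ) κ := by
  obtain ⟨s, hs, hsκ⟩ := h
  let f : List (s × ℚ) → ArensEells φ := fun t => (t.map fun p => (p.2 : ℝ) • of φ p.1).sum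
  refine ⟨range f, ?_, mk_range_le.trans (mk_list_prod_rat_le hκ hsκ)⟩
  have hcont : Continuous (of φ) := by
    have : LipschitzWith 1 (of φ) := LipschitzWith.of_dist_le_mul fun x y => by
      rw [dist_eq_norm, NNReal.coe_one, one_mul]
      exact norm_of_sub_le φ x y
    exact this.continuous
  have hc (c : X →₀ ℝ) : combination φ c ∈ closure (range f) := by
    induction c using Finsupp.induction_linear with
    | zero =>
      rw [map_zero]
      exact subset_closure ⟨[], rfl⟩
    | add c d hc hd =>
      rw [map_add]
      refine map_mem_closure₂ continuous_add hc hd ?_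
      rintro _ ⟨t, rfl⟩ _ ⟨t', rfl⟩
      exact ⟨t ++ t', by simp [f]⟩
    | single x r =>
      have h1 : combination φ (Finsupp.single x r) = r • of φ x := by simp [combination]
      rw [h1]
      refine map_mem_closure₂ (f := fun (r : ℝ) x => r • of φ x) (by fun_prop)
        (Rat.denseRange_cast r) (hs x) ?_
      rintro _ ⟨q, rfl⟩ y hy
      exact ⟨[(⟨y, hy⟩, q)], by simp [f]⟩
  exact ((denseRange_combination φ).mono (range_subset_iff.2 hc)).of_closure

theorem SeqLimit.densityLE {G : ℕ → Type u} [∀ n, NormedAddCommGroup (G n)]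
    [∀ n, NormedSpace ℝ (G n)] (j : ∀ n, G n →ₗᵢ[ℝ] G (n + 1)) {κ : Cardinal.{u}} (hκ : ℵ₀ ≤ κ)
    (h : ∀ n, DensityLE (G n) κ) : DensityLE (SeqLimit j) κ := by
  choose s hs hsκ using h
  let f : (Σ n, s n) → SeqLimit j := fun p => SeqLimit.of j p.1 p.2
  refine ⟨range f, ?_, mk_range_le.trans ?_⟩
  · refine ((SeqLimit.dense_iUnion_range_of j).mono (iUnion_subset fun n => ?_)).of_closure
    rintro _ ⟨x, rfl⟩
    refine map_mem_closure (SeqLimit.of j n).continuous (hs n x) fun y hy => ?_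
    exact ⟨⟨n, y, hy⟩, rfl⟩
  · rw [mk_sigma]
    refine (sum_le_sum _ (fun _ => κ) hsκ).trans ?_
    rw [sum_const, mk_nat, lift_aleph0, lift_id'.{0, u}]
    exact mul_le_of_le hκ hκ le_rfl

variable {E : Type u} [NormedAddCommGroup E] [NormedSpace ℝ E]

theorem Prime.densityLE {κ : Cardinal.{u}} (hκ : ℵ₀ ≤ κ) (h : DensityLE E κ) :
    DensityLE (Prime E) κ :=
  ArensEells.densityLE _ hκ (KC0.densityLE hκ h)

theorem weight_prime (E : Type u) [NormedAddCommGroup E] [NormedSpace ℝ E]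
    [Nontrivial E] : weight (Prime E) = weight E := by
  have : Infinite E := Module.Free.infinite ℝ E
  exact le_antisymm
    ((Prime.densityLE (aleph0_le_weight E) (densityLE_weight E)).weight_le (aleph0_le_weight E))
    (weight_le_of_isInducing (Prime.incl E).isometry.isUniformInducing.isInducing)

variable [CompleteSpace E]

theorem Omega.densityLE {κ : Cardinal.{u}} (hκ : ℵ₀ ≤ κ) (h : DensityLE E κ) :
    DensityLE (Omega E) κ := by
  refine SeqLimit.densityLE _ hκ fun n => ?_
  induction n with
  | zero => exact h
  | succ n ih => exact Prime.densityLE hκ ih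

variable (E)

theorem weight_omega [Nontrivial E] : weight (Omega E) = weight E := by
  have : Infinite E := Module.Free.infinite ℝ E
  exact le_antisymm
    ((Omega.densityLE (aleph0_le_weight E) (densityLE_weight E)).weight_le (aleph0_le_weight E))
    (weight_le_of_isInducing (Omega.incl E).isometry.isUniformInducing.isInducing)

theorem Omega.separableSpace [TopologicalSpace.SeparableSpace E] :
    TopologicalSpace.SeparableSpace (Omega E) := by
  obtain ⟨s, hsc, hsd⟩ := TopologicalSpace.exists_countable_dense E
  obtain ⟨t, htd, ht⟩ := Omega.densityLE (E := E) le_rfl ⟨s, hsd, le_aleph0_iff_set_countable.2 hsc⟩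
  exact ⟨t, le_aleph0_iff_set_countable.1 ht, htd⟩

end Weight

end GurarijConstruction

end

theorem mainTheorem3 (E : Type u) [NormedAddCommGroup E] [NormedSpace ℝ E]
    [CompleteSpace E] :
    -- `E'` is the space `E[K_{C,0}(E)]`
    GurarijConstruction.IsArensEells.{u, w} (GurarijConstruction.KC0.of E)
      (GurarijConstruction.Prime E)
      (GurarijConstruction.ArensEells.of (GurarijConstruction.KC0.of E)) ∧
    -- `E ⊆ E' ⊆ E_ω` are isometric linear extensions, compatible with each other
    CompleteSpace (GurarijConstruction.Prime E) ∧
    CompleteSpace (GurarijConstruction.Omega E) ∧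
    Isometry (GurarijConstruction.Prime.incl E) ∧
    Isometry (GurarijConstruction.Omega.incl E) ∧
    (∀ a : E, GurarijConstruction.Prime.incl E a =
      GurarijConstruction.ArensEells.of (GurarijConstruction.KC0.of E)
        (GurarijConstruction.KC0.of E a)) ∧
    (∀ a : E, GurarijConstruction.Omega.inclPrime E (GurarijConstruction.Prime.incl E a) =
      GurarijConstruction.Omega.incl E a) ∧
    -- the weights agree
    (Nontrivial E →
      GurarijConstruction.weight (GurarijConstruction.Prime E) = GurarijConstruction.weight E ∧
      GurarijConstruction.weight (GurarijConstruction.Omega E) = GurarijConstruction.weight E) ∧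
    -- the approximate extension property
    GurarijConstruction.HasApproxExtension.{u, v} (GurarijConstruction.Omega E) ∧
    (TopologicalSpace.SeparableSpace E →
      GurarijConstruction.IsGurarij.{u, v} (GurarijConstruction.Omega E)) := by
  refine ⟨GurarijConstruction.Prime.isArensEells E, inferInstance, inferInstance,
    (GurarijConstruction.Prime.incl E).isometry, (GurarijConstruction.Omega.incl E).isometry,
    fun _ => rfl, GurarijConstruction.SeqLimit.of_succ (GurarijConstruction.chainIncl E) 0,
    fun _ => ⟨GurarijConstruction.weight_prime E, GurarijConstruction.weight_omega E⟩,
    GurarijConstruction.Omega.hasApproxExtension E, fun _ => ?_⟩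
  exact ⟨inferInstance, GurarijConstruction.Omega.separableSpace E,
    GurarijConstruction.Omega.hasApproxExtension E⟩
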